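/- Let $N\ge 2$ and $\lambda>0$. Consider the symmetric reshuffling system: packets arrive at each of $N$ nodes according to a Poisson process of rate $\lambda$, each ordered pair $(u,v)$ of distinct nodes is a link with a Poisson process of communication epochs of rate $1$, and all these processes are independent. A newly arrived packet is available only at the node where it arrives. A packet available at exactly $i$ nodes is said to be of stage $i$; it leaves the network as soon as it is available at all $N$ nodes. Immediately before each communication epoch every packet in the network, of stage $i$ say, is, independently of the other packets, placed at a set of $i$ nodes chosen uniformly at random among all sets of $i$ nodes. Then, at a communication epoch of the link $(u,v)$, one packet chosen uniformly at random among those available at $u$ but not at $v$ (if there are any) is copied to $v$, so that its stage increases by one. Let $n(i,t)$ be the number of stage $i$ packets at time $t$. Then the continuous-time Markov chain $Y(t)=(n(i,t),\ i=1,\dots,N-1)$ on $\mathbb{Z}_{\ge 0}^{N-1}$ is positive recurrent (that is, from every state the expected time to return to this state is finite) if and only if $\lambda<1$. -/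

import Mathlib

open MeasureTheory ProbabilityTheory
open scoped NNReal ENNReal

noncomputable section

/-! ### Continuous-time Markov chains on a countable state space -/

/-- Transition rates of a continuous-time Markov chain on `S` without absorbing states:
`rate x y` is the rate of the transition from `x` to `y ≠ x`, and the total rate out of every
state is finite and positive. -/
structure TransitionRates (S : Type*) where
  rate : S → S → ℝ≥0
  rate_self : ∀ x, rate x x = 0
  summable_rate : ∀ x, Summable (rate x)
  exists_rate_pos : ∀ x, ∃ y, 0 < rate x y

namespace TransitionRates

variable {S : Type*} (Q : TransitionRates S)

/-- The total rate at which the chain leaves the state `x`. -/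
def exitRate (x : S) : ℝ≥0 := ∑' y, Q.rate x y

theorem tsum_coe_rate_ne_zero (x : S) : ∑' y, (Q.rate x y : ℝ≥0∞) ≠ 0 := by
  obtain ⟨y, hy⟩ := Q.exists_rate_pos x
  intro h
  have h' := ENNReal.tsum_eq_zero.mp h y
  exact hy.ne' (by exact_mod_cast h')

theorem tsum_coe_rate_ne_top (x : S) : ∑' y, (Q.rate x y : ℝ≥0∞) ≠ ⊤ :=
  ENNReal.tsum_coe_ne_top_iff_summable.mpr (Q.summable_rate x)

/-- The law of the next state after `x`: it is `y` with probability
`rate x y / exitRate x`. -/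
def jumpPMF (x : S) : PMF S :=
  PMF.normalize (fun y => (Q.rate x y : ℝ≥0∞)) (Q.tsum_coe_rate_ne_zero x)
    (Q.tsum_coe_rate_ne_top x)

section Law

variable [Countable S] [MeasurableSpace S] [DiscreteMeasurableSpace S]

/-- The one-step kernel of the embedded jump chain. -/
def jumpKernel : Kernel S S := Kernel.ofFunOfCountable fun x => (Q.jumpPMF x).toMeasure

instance : IsMarkovKernel Q.jumpKernel :=
  ⟨fun x => inferInstanceAs (IsProbabilityMeasure (Q.jumpPMF x).toMeasure)⟩

/-- The law of the embedded jump chain `Z₀, Z₁, Z₂, …` started at `Z₀ = x`. -/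
def jumpChainLaw (x : S) : Measure (ℕ → S) :=
  Kernel.traj (X := fun _ => S)
    (fun n => Q.jumpKernel.comap (fun h : (Finset.Iic n → S) => h ⟨n, by simp⟩)
      (measurable_pi_apply _)) 0 (fun _ => x)

/-- The exponential distribution of mean `1`. -/
def expOne : Measure ℝ := expMeasure 1

instance : IsProbabilityMeasure expOne := isProbabilityMeasure_expMeasure one_pos

/-- The underlying probability measure of the chain started at `x`: a trajectory of the jump
chain started at `x` and, independently of it, an i.i.d. sequence of exponential random variables
of mean `1`. -/
def pathLaw (x : S) : Measure ((ℕ → S) × (ℕ → ℝ)) :=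
  (Q.jumpChainLaw x).prod (Measure.infinitePi fun _ : ℕ => expOne)

end Law

/-- The time of the `n`-th jump: the `k`-th visited state `ω.1 k` is held for an exponential time
of rate `exitRate (ω.1 k)`. -/
def jumpTime (ω : (ℕ → S) × (ℕ → ℝ)) (n : ℕ) : ℝ≥0∞ :=
  ∑ k ∈ Finset.range n, ENNReal.ofReal (ω.2 k / Q.exitRate (ω.1 k))

/-- The continuous-time chain is in the state `y` at time `t`. -/
def IsAt (ω : (ℕ → S) × (ℕ → ℝ)) (t : ℝ≥0∞) (y : S) : Prop :=
  ∃ n, Q.jumpTime ω n ≤ t ∧ t < Q.jumpTime ω (n + 1) ∧ ω.1 n = y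

/-- The first time, not before the first jump, at which the chain is in the state `x`
(`⊤` if there is none). -/
def returnTime (x : S) (ω : (ℕ → S) × (ℕ → ℝ)) : ℝ≥0∞ :=
  sInf {t | Q.jumpTime ω 1 ≤ t ∧ Q.IsAt ω t x}

/-- Positive recurrence of the chain: for every state, the expected time of return to
it is finite. -/
def IsPositiveRecurrent [Countable S] [MeasurableSpace S] [DiscreteMeasurableSpace S] : Prop :=
  ∀ x, ∫⁻ ω, Q.returnTime x ω ∂(Q.pathLaw x) < ⊤

end TransitionRates

/-! ### The symmetric reshuffling system with `N` nodes -/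

namespace Reshuffling

variable {N : ℕ}

/-- States `n`: for `i : Fin (N - 1)`, `n i` is the number of packets of stage `i + 1`, that is, of
packets available at exactly `i + 1` of the `N` nodes. -/
abbrev State (N : ℕ) := Fin (N - 1) → ℕ

/-- The packets present in the state `n`, as pairs of a stage index and a label. -/
abbrev Packet (n : State N) := Σ i : Fin (N - 1), Fin (n i)

/-- The possible outcomes of a reshuffle in the state `n`: each packet of stage `i + 1` is placed
at a set of `i + 1` nodes. -/
abbrev Placement (n : State N) :=
  (p : Packet n) → {A : Finset (Fin N) // A.card = (p.1 : ℕ) + 1}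

/-- The packets that are useful on the link `(u, v)` under a given placement: those available at
`u` and not available at `v`. -/
def useful {n : State N} (ω : Placement n) (u v : Fin N) : Finset (Packet n) :=
  Finset.univ.filter fun p => u ∈ (ω p).1 ∧ v ∉ (ω p).1

/-- The state after the exogenous arrival of a packet (to stage `1`). -/
def arrive (n : State N) : State N := fun j => if (j : ℕ) = 0 then n j + 1 else n j

/-- The state after a packet of stage `i + 1` is transmitted: it moves to stage `i + 2`, and leaves
the network if `i + 2 = N`. -/
def advance (n : State N) (i : Fin (N - 1)) : State N := fun j =>
  if j = i then n j - 1 else if (j : ℕ) = (i : ℕ) + 1 then n j + 1 else n j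

/-- The probability that the state becomes `m` by a transmission at a communication epoch of the
link `(u, v)` in the state `n`: the placement of all packets is drawn uniformly at random, then a
packet that is useful on the link is drawn uniformly at random (if there is none, nothing is
transmitted). -/
def transmissionProb (u v : Fin N) (n m : State N) : ℝ≥0 :=
  (Fintype.card (Placement n) : ℝ≥0)⁻¹ * ∑ ω : Placement n, ∑ p ∈ useful ω u v,
    ((useful ω u v).card : ℝ≥0)⁻¹ * if m = advance n p.1 then 1 else 0

/-- The rate of the transition from `n` to `m`: packets arrive at each node at rate `lam`, and each
link `(u, v)`, `u ≠ v`, has communication epochs at rate `1`. -/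
def transitionRate (lam : ℝ≥0) (n m : State N) : ℝ≥0 :=
  (∑ _u : Fin N, lam * if m = arrive n then 1 else 0) +
    ∑ u : Fin N, ∑ v ∈ Finset.univ.filter (fun v => v ≠ u), transmissionProb u v n m

theorem arrive_ne (hN : 2 ≤ N) (n : State N) : n ≠ arrive n := by
  intro h
  have := congrFun h ⟨0, by omega⟩
  simp [arrive] at this

theorem advance_ne (n : State N) (p : Packet n) : n ≠ advance n p.1 := by
  intro h
  have h1 := congrFun h p.1
  have h2 := p.2.pos
  simp only [advance, if_true] at h1
  omega

theorem transitionRate_self (hN : 2 ≤ N) (lam : ℝ≥0) (n : State N) :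
    transitionRate lam n n = 0 := by
  simp [transitionRate, transmissionProb, arrive_ne hN n, advance_ne n]

theorem summable_transitionRate (lam : ℝ≥0) (n : State N) :
    Summable (transitionRate lam n) := by
  have key : ∀ a : State N, Summable fun m : State N => if m = a then (1 : ℝ≥0) else 0 :=
    fun a => (hasSum_ite_eq a 1).summable
  unfold transitionRate transmissionProb
  refine Summable.add (summable_sum fun _ _ => (key _).mul_left _)
    (summable_sum fun u _ => summable_sum fun v _ => Summable.mul_left _
      (summable_sum fun ω _ => summable_sum fun p _ => (key _).mul_left _))

theorem transitionRate_arrive_pos (hN : 2 ≤ N) {lam : ℝ≥0} (hlam : 0 < lam) (n : State N) :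
    0 < transitionRate lam n (arrive n) := by
  have : (0 : ℝ≥0) < N := by exact_mod_cast (by omega : 0 < N)
  refine add_pos_of_pos_of_nonneg ?_ (by positivity)
  simp only [if_true, mul_one, Finset.sum_const, Finset.card_univ, Fintype.card_fin, nsmul_eq_mul]
  positivity

/-- The Markov chain of the symmetric reshuffling system with `N` nodes and load `lam`. -/
def chain (N : ℕ) (hN : 2 ≤ N) (lam : ℝ≥0) (hlam : 0 < lam) : TransitionRates (State N) where
  rate := transitionRate lam
  rate_self := transitionRate_self hN lam
  summable_rate := summable_transitionRate lam
  exists_rate_pos n := ⟨arrive n, transitionRate_arrive_pos hN hlam n⟩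

end Reshuffling

end

/-! Give each packet the number of transmissions it still needs and let `work` be the total. An
arrival adds `N - 1`, at rate `N * lam`; a transmission removes exactly 1, whichever packet is
chosen. The drift of `work` is thus `N * (N - 1) * lam` minus the rate of successful transmissions
(`tsum_rate_mul_work`).

That rate never exceeds `N * (N - 1)`, the number of links. Reshuffling makes it approach this bound
geometrically in the number of packets: the placements are independent, and each packet fails to be
useful on a given link with probability at most `uselessRatio N < 1` (`le_transmissionRate_add`). If
`lam < 1`, the drift is uniformly negative outside a finite set and Foster's criterion applies, the
chain being irreducible. If `lam ≥ 1`, the drift is nonnegative everywhere; with bounded increments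
this forces survival probabilities of order at least `1/k`, so the mean return time to the empty
state diverges.

Exit rates are bounded above and away from 0, so the mean return time is finite exactly when the
mean number of jumps is. The latter is the sum of the iterates of `tabooStep` on 1
(`lintegral_returnTime_lt_top_iff`). -/

noncomputable section

namespace TransitionRates

variable {S : Type*} (Q : TransitionRates S)

/-! ### Pathwise comparison of return time and excursion time -/

/-- The operator of one step of the jump chain killed on entering `x`. -/
def tabooStep (x : S) (f : S → ℝ≥0∞) (y : S) : ℝ≥0∞ :=
  ∑' z, Q.jumpPMF y z * ({x}ᶜ : Set S).indicator f z

/-- `1` if the trajectory avoids `x` at the times `1, …, k`, and `0` otherwise. -/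
def avoid (x : S) (k : ℕ) (z : ℕ → S) : ℝ≥0∞ :=
  ∏ j ∈ Finset.range k, ({x}ᶜ : Set S).indicator 1 (z (j + 1))

theorem avoid_succ (x : S) (k : ℕ) (z : ℕ → S) :
    avoid x (k + 1) z = avoid x k z * ({x}ᶜ : Set S).indicator 1 (z (k + 1)) :=
  Finset.prod_range_succ _ _

theorem avoid_eq_one {x : S} {k : ℕ} {z : ℕ → S} (h : ∀ j < k, z (j + 1) ≠ x) :
    avoid x k z = 1 :=
  Finset.prod_eq_one fun j hj => by simp [h j (Finset.mem_range.mp hj)]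

theorem avoid_eq_zero {x : S} {k j : ℕ} {z : ℕ → S} (hj : j < k) (h : z (j + 1) = x) :
    avoid x k z = 0 :=
  Finset.prod_eq_zero (Finset.mem_range.mpr hj) (by simp [h])

theorem avoid_le_one (x : S) (k : ℕ) (z : ℕ → S) : avoid x k z ≤ 1 :=
  Finset.prod_le_one' fun j _ => Set.indicator_le_self' (by simp) _

/-- The time spent before the first return to `x`. -/
def excursionTime (x : S) (ω : (ℕ → S) × (ℕ → ℝ)) : ℝ≥0∞ :=
  ∑' k, avoid x k ω.1 * ENNReal.ofReal (ω.2 k / Q.exitRate (ω.1 k))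

theorem jumpTime_mono (ω : (ℕ → S) × (ℕ → ℝ)) : Monotone (Q.jumpTime ω) := fun _ _ h =>
  Finset.sum_le_sum_of_subset (Finset.range_mono h)

theorem excursionTime_le_of_eq {x : S} {ω : (ℕ → S) × (ℕ → ℝ)} {n : ℕ} (hn : 0 < n)
    (h : ω.1 n = x) : Q.excursionTime x ω ≤ Q.jumpTime ω n := by
  obtain ⟨m, rfl⟩ := Nat.exists_eq_add_of_lt hn
  unfold excursionTime jumpTime
  rw [tsum_eq_sum (s := Finset.range (0 + m + 1))]
  · exact Finset.sum_le_sum fun k _ => mul_le_of_le_one_left' (avoid_le_one _ _ _)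
  · intro k hk
    rw [Finset.mem_range, not_lt] at hk
    rw [avoid_eq_zero (j := 0 + m) (by omega) h, zero_mul]

theorem excursionTime_le_returnTime (x : S) (ω : (ℕ → S) × (ℕ → ℝ)) :
    Q.excursionTime x ω ≤ Q.returnTime x ω := by
  refine le_sInf ?_
  rintro t ⟨h1, n, hn, hn', hx⟩
  have hpos : 0 < n := by
    rcases Nat.eq_zero_or_pos n with rfl | h
    · exact absurd (lt_of_le_of_lt h1 hn') (lt_irrefl _)
    · exact h
  exact (Q.excursionTime_le_of_eq hpos hx).trans hn

/-- Positive holding times are needed because a state held for time zero is invisible to `IsAt`;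
with them, the chain is at `x` at the jump time of its first return. -/
theorem returnTime_le_excursionTime (hq : ∀ y, 0 < Q.exitRate y) {x : S}
    {ω : (ℕ → S) × (ℕ → ℝ)} (hω : ∀ k, 0 < ω.2 k) (hret : ∃ n, ω.1 (n + 1) = x) :
    Q.returnTime x ω ≤ Q.excursionTime x ω := by
  classical
  have hn : ω.1 (Nat.find hret + 1) = x := Nat.find_spec hret
  have hmin : ∀ j < Nat.find hret, ω.1 (j + 1) ≠ x := fun j hj => Nat.find_min hret hj
  set n := Nat.find hret
  have hlt : Q.jumpTime ω (n + 1) < Q.jumpTime ω (n + 1 + 1) := by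
    unfold jumpTime
    rw [Finset.sum_range_succ _ (n + 1)]
    refine ENNReal.lt_add_right ?_ ?_
    · exact ENNReal.sum_ne_top.mpr fun k _ => ENNReal.ofReal_ne_top
    · have := hq (ω.1 (n + 1))
      have := hω (n + 1)
      rw [Ne, ENNReal.ofReal_eq_zero, not_le]
      positivity
  have hmem : Q.jumpTime ω (n + 1) ∈ {t | Q.jumpTime ω 1 ≤ t ∧ Q.IsAt ω t x} :=
    ⟨Q.jumpTime_mono ω (by omega), n + 1, le_rfl, hlt, hn⟩
  refine (sInf_le hmem).trans ?_
  unfold excursionTime jumpTime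
  refine le_trans (le_of_eq ?_) (ENNReal.sum_le_tsum (Finset.range (n + 1)))
  refine Finset.sum_congr rfl fun k hk => ?_
  rw [Finset.mem_range] at hk
  rw [avoid_eq_one fun j hj => hmin j (by omega), one_mul]

theorem tsum_avoid_eq_top {x : S} {z : ℕ → S} (h : ¬ ∃ n, z (n + 1) = x) :
    ∑' k, avoid x k z = ⊤ := by
  push Not at h
  simp only [avoid_eq_one fun j _ => h j]
  exact ENNReal.tsum_const_eq_top_of_ne_zero one_ne_zero

/-! ### Expectations along the jump chain -/

section Law

variable [MeasurableSpace S] [DiscreteMeasurableSpace S]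

@[fun_prop]
theorem measurable_avoid (x : S) (k : ℕ) : Measurable (avoid x k) :=
  Finset.measurable_fun_prod _ fun j _ =>
    (Measurable.of_discrete (f := ({x}ᶜ : Set S).indicator (1 : S → ℝ≥0∞))).comp
      (measurable_pi_apply (j + 1))

variable [Countable S]

theorem lintegral_jumpKernel (f : S → ℝ≥0∞) (y : S) :
    ∫⁻ z, f z ∂(Q.jumpKernel y) = ∑' z, Q.jumpPMF y z * f z := by
  have : Q.jumpKernel y = (Q.jumpPMF y).toMeasure := rfl
  rw [this, lintegral_countable']
  refine tsum_congr fun z => ?_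
  rw [PMF.toMeasure_apply_singleton _ _ (measurableSet_singleton z), mul_comm]

instance (x : S) : IsProbabilityMeasure (Q.jumpChainLaw x) := by
  unfold jumpChainLaw; infer_instance

theorem lintegral_jumpChainLaw_zero (x : S) (f : S → ℝ≥0∞) :
    ∫⁻ z, f (z 0) ∂(Q.jumpChainLaw x) = f x := by
  have hf : Measurable f := Measurable.of_discrete
  unfold jumpChainLaw
  rw [Kernel.lintegral_traj (X := fun _ => S) _ (by fun_prop)]
  simp [Function.updateFinset]

/-- The Markov property at time `k`: the joint law of the first coordinates up to `k` and the next
one is a composition-product with the jump kernel. -/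
theorem lintegral_jumpChainLaw_succ (x : S) (k : ℕ) {G : (Finset.Iic k → S) → ℝ≥0∞}
    (hG : Measurable G) (f : S → ℝ≥0∞) :
    ∫⁻ z, G (Preorder.frestrictLe k z) * f (z (k + 1)) ∂(Q.jumpChainLaw x) =
      ∫⁻ z, G (Preorder.frestrictLe k z) * ∑' y, Q.jumpPMF (z k) y * f y
        ∂(Q.jumpChainLaw x) := by
  have hf : Measurable f := Measurable.of_discrete
  have hPf : Measurable fun y => ∑' w, Q.jumpPMF y w * f w := Measurable.of_discrete
  unfold jumpChainLaw
  set κ : (n : ℕ) → Kernel (Finset.Iic n → S) S :=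
    fun n => Q.jumpKernel.comap (fun h : (Finset.Iic n → S) => h ⟨n, by simp⟩)
      (measurable_pi_apply _) with hκ
  have h1 := Kernel.partialTraj_compProd_eq_map_traj (X := fun _ => S) (κ := κ)
    (Nat.zero_le k) (x₀ := fun _ => x)
  have h2 := congrArg (fun μ => ∫⁻ p, G p.1 * f p.2 ∂μ) h1
  rw [Measure.lintegral_compProd (by fun_prop), lintegral_map (by fun_prop) (by fun_prop)] at h2
  rw [← h2, ← Kernel.traj_map_frestrictLe_apply, lintegral_map _ (by fun_prop)]
  · refine lintegral_congr fun z => ?_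
    dsimp only
    rw [lintegral_const_mul _ hf]
    congr 1
    rw [hκ, Kernel.comap_apply, lintegral_jumpKernel]
    rfl
  · refine Measurable.lintegral_kernel_prod_right' (f := fun p => G p.1 * f p.2) (by fun_prop)

theorem lintegral_avoid_mul (x y : S) (k : ℕ) (f : S → ℝ≥0∞) :
    ∫⁻ z, avoid x k z * f (z k) ∂(Q.jumpChainLaw y) = (Q.tabooStep x)^[k] f y := by
  induction k generalizing f with
  | zero => simpa [avoid] using Q.lintegral_jumpChainLaw_zero y f
  | succ k ih =>
    rw [Function.iterate_succ_apply, ← ih]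
    -- `avoid x k` depends only on the coordinates up to `k`; `G` is that function of the past.
    let G : (Finset.Iic k → S) → ℝ≥0∞ := fun h =>
      ∏ j : Fin k, ({x}ᶜ : Set S).indicator 1 (h ⟨j + 1, by simp⟩)
    have hG : Measurable G := Finset.measurable_fun_prod _ fun j _ =>
      (Measurable.of_discrete (f := ({x}ᶜ : Set S).indicator (1 : S → ℝ≥0∞))).comp
        (measurable_pi_apply _)
    have hGa : ∀ z, G (Preorder.frestrictLe k z) = avoid x k z := fun z =>
      (Finset.prod_range fun j => ({x}ᶜ : Set S).indicator (1 : S → ℝ≥0∞) (z (j + 1))).symm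
    have h := Q.lintegral_jumpChainLaw_succ y k hG (({x}ᶜ : Set S).indicator f)
    simp only [hGa] at h
    refine Eq.trans (lintegral_congr fun z => ?_) h
    rw [avoid_succ, mul_assoc]
    congr 1
    by_cases hz : z (k + 1) = x <;> simp [hz]

/-! ### Return times and taboo probabilities -/

theorem expMeasure_one_eq : (expOne : Measure ℝ) = volume.withDensity (exponentialPDF 1) := rfl

theorem lintegral_ofReal_expOne_ne_top : ∫⁻ t, ENNReal.ofReal t ∂expOne ≠ ⊤ := by
  have hm : Measurable (exponentialPDF 1) := by unfold exponentialPDF; fun_prop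
  rw [expMeasure_one_eq, lintegral_withDensity_eq_lintegral_mul _ hm (by fun_prop)]
  -- The mean is the Gamma integral at 2, whose integrand carries the exponent `2 - 1`.
  have hint : IntegrableOn (fun t : ℝ => Real.exp (-t) * t ^ ((2 : ℝ) - 1)) (Set.Ioi 0) :=
    Real.GammaIntegral_convergent (by norm_num)
  refine ne_top_of_le_ne_top (hint.lintegral_lt_top.ne) ?_
  rw [← lintegral_indicator measurableSet_Ioi]
  refine lintegral_mono fun t => ?_
  by_cases ht : 0 < t
  · rw [Set.indicator_of_mem (Set.mem_Ioi.mpr ht), Pi.mul_apply, exponentialPDF_of_nonneg ht.le,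
      ← ENNReal.ofReal_mul (by positivity)]
    norm_num
  · simp [ENNReal.ofReal_of_nonpos (not_lt.mp ht)]

theorem ae_pos_expOne : ∀ᵐ t ∂expOne, 0 < t := by
  have hm : Measurable (exponentialPDF 1) := by unfold exponentialPDF; fun_prop
  rw [expMeasure_one_eq, ae_withDensity_iff hm]
  have h0 : ∀ᵐ t : ℝ, t ≠ 0 := Measure.ae_ne volume 0
  filter_upwards [h0] with t ht h
  by_contra hlt
  exact h (exponentialPDF_of_neg (lt_of_le_of_ne (not_lt.mp hlt) ht))

theorem lintegral_ofReal_expOne_ne_zero : ∫⁻ t, ENNReal.ofReal t ∂expOne ≠ 0 := by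
  intro h
  rw [lintegral_eq_zero_iff (by fun_prop)] at h
  have hf : ∀ᵐ _t ∂expOne, False := by
    filter_upwards [h, ae_pos_expOne] with t h1 h2
    simp only [Pi.zero_apply, ENNReal.ofReal_eq_zero] at h1
    linarith
  exact hf.exists.elim fun _ h => h

/-- The expectation factors because the jump chain and the holding times are independent. -/
theorem lintegral_pathLaw_avoid (x : S) (k : ℕ) :
    ∫⁻ ω, avoid x k ω.1 * ENNReal.ofReal (ω.2 k) ∂(Q.pathLaw x) =
      (Q.tabooStep x)^[k] 1 x * ∫⁻ t, ENNReal.ofReal t ∂expOne := by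
  unfold pathLaw
  rw [lintegral_prod_mul (f := avoid x k) (g := fun e : ℕ → ℝ => ENNReal.ofReal (e k))
    (by fun_prop) ((ENNReal.measurable_ofReal.comp (measurable_pi_apply k)).aemeasurable)]
  congr 1
  · simpa using Q.lintegral_avoid_mul x x k 1
  · exact (measurePreserving_eval_infinitePi (fun _ : ℕ => expOne) k).lintegral_comp
      (by fun_prop : Measurable ENNReal.ofReal)

theorem ae_pos_holding (x : S) : ∀ᵐ ω ∂(Q.pathLaw x), ∀ k, 0 < ω.2 k := by
  rw [ae_all_iff]
  intro k
  have h1 : ∀ᵐ e ∂(Measure.infinitePi fun _ : ℕ => expOne), 0 < e k :=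
    (measurePreserving_eval_infinitePi (fun _ : ℕ => expOne) k).quasiMeasurePreserving.ae
      ae_pos_expOne
  exact Measure.quasiMeasurePreserving_snd.ae h1

/-- A path that never returns has infinitely many avoidance indicators equal to 1, so a finite mean
excludes such paths almost surely. -/
theorem ae_returns (x : S) (h : ∑' k, (Q.tabooStep x)^[k] 1 x ≠ ⊤) :
    ∀ᵐ ω ∂(Q.pathLaw x), ∃ n, ω.1 (n + 1) = x := by
  have h1 : ∫⁻ z, ∑' k, avoid x k z ∂(Q.jumpChainLaw x) ≠ ⊤ := by
    rw [lintegral_tsum fun k => (measurable_avoid x k).aemeasurable]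
    convert h using 3 with k
    simpa using Q.lintegral_avoid_mul x x k 1
  have h2 : ∀ᵐ z ∂(Q.jumpChainLaw x), ∃ n, z (n + 1) = x := by
    filter_upwards [ae_lt_top (by fun_prop) h1] with z hz
    by_contra hn
    exact hz.ne (tsum_avoid_eq_top hn)
  exact Measure.quasiMeasurePreserving_fst.ae h2

theorem lintegral_excursionTime_le {a : ℝ≥0} (ha : 0 < a) (hQ : ∀ y, a ≤ Q.exitRate y) (x : S) :
    ∫⁻ ω, Q.excursionTime x ω ∂(Q.pathLaw x) ≤
      (a : ℝ≥0∞)⁻¹ * ((∑' k, (Q.tabooStep x)^[k] 1 x) * ∫⁻ t, ENNReal.ofReal t ∂expOne) := by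
  have hm : ∀ k, Measurable fun ω : (ℕ → S) × (ℕ → ℝ) =>
      avoid x k ω.1 * ENNReal.ofReal (ω.2 k) := fun k => by fun_prop
  rw [← ENNReal.tsum_mul_right]
  simp_rw [← lintegral_pathLaw_avoid]
  rw [← lintegral_tsum fun k => (hm k).aemeasurable,
    ← lintegral_const_mul _ (Measurable.tsum hm)]
  refine lintegral_mono fun ω => ?_
  simp only
  unfold excursionTime
  rw [← ENNReal.tsum_mul_left]
  refine ENNReal.tsum_le_tsum fun k => ?_
  rw [mul_left_comm]
  gcongr
  rw [← ENNReal.ofReal_coe_nnreal, ← ENNReal.ofReal_inv_of_pos (by exact_mod_cast ha),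
    ← ENNReal.ofReal_mul (by positivity), mul_comm, ← div_eq_mul_inv]
  rcases le_or_gt 0 (ω.2 k) with h | h
  · gcongr
    exact hQ _
  · rw [ENNReal.ofReal_of_nonpos (div_nonpos_of_nonpos_of_nonneg h.le (by positivity))]
    exact zero_le

theorem le_lintegral_excursionTime {b : ℝ≥0} (hb : ∀ y, Q.exitRate y ≤ b)
    (hQ : ∀ y, 0 < Q.exitRate y) (x : S) :
    (b : ℝ≥0∞)⁻¹ * ((∑' k, (Q.tabooStep x)^[k] 1 x) * ∫⁻ t, ENNReal.ofReal t ∂expOne) ≤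
      ∫⁻ ω, Q.excursionTime x ω ∂(Q.pathLaw x) := by
  have hb0 : 0 < b := (hQ x).trans_le (hb x)
  have hm : ∀ k, Measurable fun ω : (ℕ → S) × (ℕ → ℝ) =>
      avoid x k ω.1 * ENNReal.ofReal (ω.2 k) := fun k => by fun_prop
  rw [← ENNReal.tsum_mul_right]
  simp_rw [← lintegral_pathLaw_avoid]
  rw [← lintegral_tsum fun k => (hm k).aemeasurable,
    ← lintegral_const_mul _ (Measurable.tsum hm)]
  refine lintegral_mono fun ω => ?_
  simp only
  unfold excursionTime
  rw [← ENNReal.tsum_mul_left]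
  refine ENNReal.tsum_le_tsum fun k => ?_
  rw [mul_left_comm]
  gcongr
  have hq := hQ (ω.1 k)
  rw [← ENNReal.ofReal_coe_nnreal, ← ENNReal.ofReal_inv_of_pos (by exact_mod_cast hb0),
    ← ENNReal.ofReal_mul (by positivity), mul_comm, ← div_eq_mul_inv]
  rcases le_or_gt 0 (ω.2 k) with h | h
  · gcongr
    exact hb _
  · rw [ENNReal.ofReal_of_nonpos (div_nonpos_of_nonpos_of_nonneg h.le (by positivity))]
    exact zero_le

/-- If the exit rates are bounded and bounded away from `0`, then the expected return time to `x`
is finite if and only if the expected number of jumps until the return is. -/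
theorem lintegral_returnTime_lt_top_iff {a b : ℝ≥0} (ha : 0 < a) (hQa : ∀ y, a ≤ Q.exitRate y)
    (hQb : ∀ y, Q.exitRate y ≤ b) (x : S) :
    ∫⁻ ω, Q.returnTime x ω ∂(Q.pathLaw x) < ⊤ ↔ ∑' k, (Q.tabooStep x)^[k] 1 x < ⊤ := by
  have hQ : ∀ y, 0 < Q.exitRate y := fun y => ha.trans_le (hQa y)
  constructor
  · intro h
    have h1 := ((Q.le_lintegral_excursionTime hQb hQ x).trans
      (lintegral_mono fun ω => Q.excursionTime_le_returnTime x ω)).trans_lt h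
    by_contra htop
    rw [not_lt, top_le_iff] at htop
    rw [htop, ENNReal.top_mul lintegral_ofReal_expOne_ne_zero,
      ENNReal.mul_top (ENNReal.inv_ne_zero.mpr ENNReal.coe_ne_top)] at h1
    exact lt_irrefl _ h1
  · intro h
    have h1 : ∫⁻ ω, Q.returnTime x ω ∂(Q.pathLaw x) ≤
        ∫⁻ ω, Q.excursionTime x ω ∂(Q.pathLaw x) := by
      refine lintegral_mono_ae ?_
      filter_upwards [Q.ae_pos_holding x, Q.ae_returns x h.ne] with ω h1 h2
      exact Q.returnTime_le_excursionTime hQ h1 h2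
    refine (h1.trans (Q.lintegral_excursionTime_le ha hQa x)).trans_lt ?_
    exact ENNReal.mul_lt_top (ENNReal.inv_lt_top.mpr (by exact_mod_cast ha))
      (ENNReal.mul_lt_top h lintegral_ofReal_expOne_ne_top.lt_top)

end Law

end TransitionRates
end

noncomputable section

namespace TransitionRates

variable {S : Type*} (Q : TransitionRates S)

/-! ### Drift criteria for the jump chain -/

/-- The operator of one step of the jump chain. -/
def step (f : S → ℝ≥0∞) (y : S) : ℝ≥0∞ := ∑' z, Q.jumpPMF y z * f z

theorem step_eq (f : S → ℝ≥0∞) (y : S) :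
    Q.step f y = (Q.exitRate y : ℝ≥0∞)⁻¹ * ∑' z, (Q.rate y z : ℝ≥0∞) * f z := by
  unfold step jumpPMF exitRate
  rw [ENNReal.coe_tsum (Q.summable_rate y), ← ENNReal.tsum_mul_left]
  refine tsum_congr fun z => ?_
  rw [PMF.normalize_apply]
  ring

theorem jumpPMF_ne_zero_iff {y z : S} : Q.jumpPMF y z ≠ 0 ↔ 0 < Q.rate y z := by
  unfold jumpPMF
  rw [← PMF.mem_support_iff, PMF.mem_support_normalize_iff, pos_iff_ne_zero, ENNReal.coe_ne_zero]

theorem tabooStep_mono (x : S) : Monotone (Q.tabooStep x) := fun _ _ h y =>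
  ENNReal.tsum_le_tsum fun z => by
    gcongr
    exact h z

theorem tabooStep_le_step (x : S) (f : S → ℝ≥0∞) (y : S) : Q.tabooStep x f y ≤ Q.step f y :=
  ENNReal.tsum_le_tsum fun z => by
    gcongr
    exact Set.indicator_le_self _ _ z

theorem tabooStep_eq_step {x : S} {f : S → ℝ≥0∞} (hf : f x = 0) (y : S) :
    Q.tabooStep x f y = Q.step f y := by
  refine tsum_congr fun z => ?_
  by_cases hz : z = x <;> simp [hz, hf]

theorem tabooStep_add (x : S) (f g : S → ℝ≥0∞) (y : S) :
    Q.tabooStep x (fun z => f z + g z) y = Q.tabooStep x f y + Q.tabooStep x g y := by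
  unfold tabooStep
  rw [← ENNReal.tsum_add]
  refine tsum_congr fun z => ?_
  by_cases hz : z = x <;> simp [hz, mul_add]

theorem tabooStep_const_mul (x : S) (c : ℝ≥0∞) (f : S → ℝ≥0∞) (y : S) :
    Q.tabooStep x (fun z => c * f z) y = c * Q.tabooStep x f y := by
  unfold tabooStep
  rw [← ENNReal.tsum_mul_left]
  refine tsum_congr fun z => ?_
  by_cases hz : z = x <;> simp [hz, mul_left_comm]

theorem tabooStep_sum (x : S) {ι : Type*} (s : Finset ι) (f : ι → S → ℝ≥0∞) (y : S) :
    Q.tabooStep x (fun z => ∑ i ∈ s, f i z) y = ∑ i ∈ s, Q.tabooStep x (f i) y := by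
  classical
  induction s using Finset.induction_on with
  | empty => simp [tabooStep]
  | insert i s hi ih =>
    simp only [Finset.sum_insert hi]
    rw [tabooStep_add, ih]

theorem tabooStep_one_le (x : S) (y : S) : Q.tabooStep x 1 y ≤ 1 := by
  refine (Q.tabooStep_le_step x 1 y).trans (le_of_eq ?_)
  simp [step, PMF.tsum_coe]

theorem iterate_tabooStep_antitone (x : S) : Antitone fun k => (Q.tabooStep x)^[k] 1 := by
  refine antitone_nat_of_succ_le fun k => ?_
  rw [Function.iterate_succ_apply]
  exact (Q.tabooStep_mono x).iterate k (Q.tabooStep_one_le x)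

theorem iterate_tabooStep_le_one (x : S) (k : ℕ) (y : S) : (Q.tabooStep x)^[k] 1 y ≤ 1 :=
  Q.iterate_tabooStep_antitone x (Nat.zero_le k) y

/-- First-step analysis for the mean number of steps before return, truncated at `n + 1`. -/
theorem one_add_tabooStep_sum (x : S) (n : ℕ) (y : S) :
    Q.tabooStep x (fun z => ∑ k ∈ Finset.range n, (Q.tabooStep x)^[k] 1 z) y + 1 =
      ∑ k ∈ Finset.range (n + 1), (Q.tabooStep x)^[k] 1 y := by
  rw [tabooStep_sum, Finset.sum_range_succ']
  simp only [Function.iterate_succ_apply']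
  rfl

/-- By first-step analysis and induction, `h` dominates every truncated mean return time scaled by
`ε`. -/
theorem mul_tsum_iterate_tabooStep_le {x : S} {h : S → ℝ≥0∞} {ε : ℝ≥0∞}
    (hh : ∀ y, Q.tabooStep x h y + ε ≤ h y) (y : S) :
    ε * ∑' k, (Q.tabooStep x)^[k] 1 y ≤ h y := by
  have key : ∀ n y, ε * ∑ k ∈ Finset.range n, (Q.tabooStep x)^[k] 1 y ≤ h y := by
    intro n
    induction n with
    | zero => simp
    | succ n ih =>
      intro y
      rw [← one_add_tabooStep_sum, mul_add, ← tabooStep_const_mul, mul_one]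
      exact (add_le_add_left (Q.tabooStep_mono x ih y) _).trans (hh y)
  rw [ENNReal.tsum_eq_iSup_nat, ENNReal.mul_iSup]
  exact iSup_le fun n => key n y

theorem iterate_tabooStep_succ_lt_one {x y z : S} {k : ℕ} (hyz : 0 < Q.rate y z)
    (hz : z = x ∨ (Q.tabooStep x)^[k] 1 z < 1) : (Q.tabooStep x)^[k + 1] 1 y < 1 := by
  rw [Function.iterate_succ_apply', ← (Q.jumpPMF y).tsum_coe]
  have hle : ∀ w, Q.jumpPMF y w * ({x}ᶜ : Set S).indicator ((Q.tabooStep x)^[k] 1) w ≤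
      Q.jumpPMF y w := fun w =>
    mul_le_of_le_one_right' ((Set.indicator_le_self _ _ w).trans (Q.iterate_tabooStep_le_one x k w))
  refine ENNReal.tsum_lt_tsum (i := z)
    (ne_top_of_le_ne_top (Q.jumpPMF y).tsum_coe_ne_top (ENNReal.tsum_le_tsum hle)) hle ?_
  have hp := Q.jumpPMF_ne_zero_iff.mpr hyz
  have hlt : ({x}ᶜ : Set S).indicator ((Q.tabooStep x)^[k] 1) z < 1 := by
    rcases hz with rfl | hz
    · simp
    · exact (Set.indicator_le_self _ _ z).trans_lt hz
  calc _ < Q.jumpPMF y z * 1 :=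
        (ENNReal.mul_lt_mul_iff_right hp ((Q.jumpPMF y).apply_ne_top z)).mpr hlt
    _ = _ := mul_one _

theorem exists_iterate_tabooStep_lt_one {x y : S}
    (h : Relation.TransGen (fun a b => 0 < Q.rate a b) y x) :
    ∃ k, (Q.tabooStep x)^[k] 1 y < 1 := by
  induction h using Relation.TransGen.head_induction_on with
  | single h => exact ⟨1, Q.iterate_tabooStep_succ_lt_one (k := 0) h (Or.inl rfl)⟩
  | head h _ ih =>
    obtain ⟨k, hk⟩ := ih
    exact ⟨k + 1, Q.iterate_tabooStep_succ_lt_one h (Or.inr hk)⟩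

/-- **Foster's criterion**: a function with negative drift outside a finite set, from which `x` can
be reached, makes the expected return time to `x` finite. -/
theorem tsum_iterate_tabooStep_lt_top_of_drift {x : S} {V : S → ℝ≥0∞} (hV : V x ≠ ⊤)
    {F : Finset S} {ε b : ℝ≥0∞} (hε : ε ≠ 0) (hb : b ≠ ⊤)
    (hout : ∀ y ∉ F, Q.step V y + ε ≤ V y) (hin : ∀ y ∈ F, Q.step V y + ε ≤ b)
    (hF : ∀ y ∈ F, Relation.TransGen (fun a b => 0 < Q.rate a b) y x) :
    ∑' k, (Q.tabooStep x)^[k] 1 x < ⊤ := by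
  set a : ℕ → S → ℝ≥0∞ := fun k => (Q.tabooStep x)^[k] 1 with ha
  have ha_top : ∀ k y, a k y ≠ ⊤ := fun k y =>
    ne_top_of_le_ne_top ENNReal.one_ne_top (Q.iterate_tabooStep_le_one x k y)
  -- Survival probabilities decrease in `k`, so one horizon serves the whole finite set.
  obtain ⟨K, hK⟩ : ∃ K, ∀ y ∈ F, a K y < 1 := by
    choose! k hk using fun y hy => Q.exists_iterate_tabooStep_lt_one (hF y hy)
    exact ⟨F.sup k, fun y hy =>
      (Q.iterate_tabooStep_antitone x (Finset.le_sup hy) y).trans_lt (hk y hy)⟩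
  obtain ⟨δ, hδ0, hδ_top, hδ⟩ : ∃ δ : ℝ≥0∞, δ ≠ 0 ∧ δ ≠ ⊤ ∧ ∀ y ∈ F, a K y + δ ≤ 1 := by
    -- The minimum with 1 keeps `δ` finite when `F` is empty.
    refine ⟨min 1 (F.inf fun y => 1 - a K y), ?_, ?_, fun y hy => ?_⟩
    · rw [← pos_iff_ne_zero, lt_min_iff, Finset.lt_inf_iff (by simp)]
      exact ⟨one_pos, fun y hy => tsub_pos_of_lt (hK y hy)⟩
    · exact ne_top_of_le_ne_top ENNReal.one_ne_top (min_le_left _ _)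
    · calc a K y + min 1 (F.inf fun y => 1 - a K y) ≤ a K y + (1 - a K y) := by
            gcongr
            exact (min_le_right _ _).trans (Finset.inf_le hy)
        _ = 1 := add_tsub_cancel_of_le (hK y hy).le
  -- The mean return time truncated at `K` has taboo drift `a K - 1`: nonpositive everywhere and at
  -- most `-δ` on `F`. Adding `B * s` with `B = b / δ` to `V` repairs the drift on `F` without
  -- spoiling it elsewhere.
  set s : S → ℝ≥0∞ := fun y => ∑ k ∈ Finset.range K, a k y with hs
  have hTs : ∀ y, Q.tabooStep x s y + 1 = s y + a K y := fun y => by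
    rw [hs, ha, one_add_tabooStep_sum, Finset.sum_range_succ]
  set B := b / δ with hB
  have hB_top : B ≠ ⊤ := ENNReal.div_ne_top hb hδ0
  have hBδ : B * δ = b := ENNReal.div_mul_cancel hδ0 hδ_top
  have hTs_le : ∀ y, Q.tabooStep x s y ≤ s y := fun y => by
    refine (ENNReal.add_le_add_iff_right ENNReal.one_ne_top).mp ?_
    rw [hTs]
    gcongr
    exact Q.iterate_tabooStep_le_one x K y
  have hTs_F : ∀ y ∈ F, Q.tabooStep x s y + δ ≤ s y := fun y hy => by
    refine (ENNReal.add_le_add_iff_right (ha_top K y)).mp ?_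
    rw [← hTs, add_assoc, add_comm δ]
    gcongr
    exact hδ y hy
  have hdrift : ∀ y, Q.tabooStep x (fun z => V z + B * s z) y + ε ≤ V y + B * s y := fun y => by
    rw [tabooStep_add, tabooStep_const_mul]
    have h1 := Q.tabooStep_le_step x V y
    by_cases hy : y ∈ F
    · calc _ ≤ (Q.step V y + ε) + B * Q.tabooStep x s y := by
            rw [add_right_comm]; gcongr
        _ ≤ b + B * Q.tabooStep x s y := by gcongr; exact hin y hy
        _ = B * (Q.tabooStep x s y + δ) := by rw [mul_add, hBδ, add_comm]
        _ ≤ B * s y := by gcongr; exact hTs_F y hy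
        _ ≤ _ := le_add_self
    · calc _ ≤ (Q.step V y + ε) + B * Q.tabooStep x s y := by
            rw [add_right_comm]; gcongr
        _ ≤ _ := by gcongr; exacts [hout y hy, hTs_le y]
  have hfin : V x + B * s x < ⊤ := by
    refine ENNReal.add_lt_top.mpr ⟨hV.lt_top, ENNReal.mul_lt_top hB_top.lt_top ?_⟩
    exact ENNReal.sum_lt_top.mpr fun k _ => (ha_top k x).lt_top
  have hle := (Q.mul_tsum_iterate_tabooStep_le hdrift x).trans_lt hfin
  exact (ENNReal.lt_top_of_mul_ne_top_right hle.ne hε)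

/-- Along a surviving path `W` gains at most `c` per step, so its killed expectation is controlled
by the survival probability. -/
theorem iterate_tabooStep_le_of_bounded_increments {x : S} {W : S → ℝ≥0∞} {c : ℝ≥0∞}
    (hc : ∀ y z, 0 < Q.rate y z → W z ≤ W y + c) (k : ℕ) (y : S) :
    (Q.tabooStep x)^[k] W y ≤ (W y + c * k) * (Q.tabooStep x)^[k] 1 y := by
  induction k generalizing y with
  | zero => simp
  | succ k ih =>
    rw [Function.iterate_succ_apply', Function.iterate_succ_apply']
    conv_rhs => rw [tabooStep, ← ENNReal.tsum_mul_left]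
    refine ENNReal.tsum_le_tsum fun z => ?_
    by_cases hp : Q.jumpPMF y z = 0
    · simp [hp]
    by_cases hz : z = x
    · simp [hz]
    have hz' : z ∈ ({x}ᶜ : Set S) := hz
    rw [Set.indicator_of_mem hz', Set.indicator_of_mem hz', mul_left_comm]
    gcongr
    refine (ih z).trans (mul_le_mul' ?_ le_rfl)
    calc W z + c * k ≤ W y + c + c * k := by gcongr; exact hc y z (Q.jumpPMF_ne_zero_iff.mp hp)
      _ = W y + c * (k + 1 : ℕ) := by push_cast; ring

theorem tsum_inv_natCast_succ_eq_top : ∑' k : ℕ, ((k + 1 : ℕ) : ℝ≥0∞)⁻¹ = ⊤ := by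
  by_contra h
  have h1 : ∀ k : ℕ, ((k + 1 : ℕ) : ℝ≥0∞)⁻¹ = (((k + 1 : ℕ) : ℝ≥0)⁻¹ : ℝ≥0) := fun k => by
    rw [ENNReal.coe_inv (by positivity), ENNReal.coe_natCast]
  simp_rw [h1] at h
  have h2 := NNReal.summable_coe.mpr (ENNReal.tsum_coe_ne_top_iff_summable.mp h)
  refine Real.not_summable_natCast_inv ((summable_nat_add_iff 1).mp ?_)
  simpa using h2

/-- A function with bounded increments and nonnegative drift, which vanishes at `x` and has
positive drift there, makes the expected return time to `x` infinite. -/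
theorem tsum_iterate_tabooStep_eq_top_of_drift {x : S} {W : S → ℝ≥0∞} {c : ℝ≥0∞} (hc_top : c ≠ ⊤)
    (hc : ∀ y z, 0 < Q.rate y z → W z ≤ W y + c) (hx : W x = 0)
    (hW : ∀ y, W y ≤ Q.step W y) (hpos : Q.step W x ≠ 0) :
    ∑' k, (Q.tabooStep x)^[k] 1 x = ⊤ := by
  -- Killing at `x` loses nothing since `W x = 0`, so `W` is subharmonic for the killed chain too.
  have hmono : Monotone fun k => (Q.tabooStep x)^[k] W := by
    refine monotone_nat_of_le_succ fun k => ?_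
    rw [Function.iterate_succ_apply]
    refine (Q.tabooStep_mono x).iterate k fun y => ?_
    rw [Q.tabooStep_eq_step hx]
    exact hW y
  -- The killed expectation stays at least `Q.step W x` while `W` is at most `c * (k + 1)`; hence
  -- survival is bounded below by a harmonic term.
  have hlow : ∀ k : ℕ, Q.step W x * ((k + 1 : ℕ) : ℝ≥0∞)⁻¹ ≤ c * (Q.tabooStep x)^[k + 1] 1 x := by
    intro k
    rw [← div_eq_mul_inv]
    refine ENNReal.div_le_of_le_mul ?_
    calc Q.step W x = (Q.tabooStep x)^[1] W x := (Q.tabooStep_eq_step hx x).symm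
      _ ≤ (Q.tabooStep x)^[k + 1] W x := hmono (by omega : 1 ≤ k + 1) x
      _ ≤ (W x + c * (k + 1 : ℕ)) * (Q.tabooStep x)^[k + 1] 1 x :=
        Q.iterate_tabooStep_le_of_bounded_increments hc (k + 1) x
      _ = _ := by rw [hx]; ring
  have h1 := ENNReal.tsum_le_tsum hlow
  rw [ENNReal.tsum_mul_left, tsum_inv_natCast_succ_eq_top, ENNReal.mul_top hpos,
    ENNReal.tsum_mul_left, top_le_iff] at h1
  have h2 : ∑' k, (Q.tabooStep x)^[k + 1] 1 x = ⊤ := by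
    by_contra h
    exact ENNReal.mul_ne_top hc_top h h1
  rw [← top_le_iff, ← h2]
  exact ENNReal.tsum_comp_le_tsum_of_injective (add_left_injective 1)
    (fun k => (Q.tabooStep x)^[k] 1 x)

end TransitionRates
end

noncomputable section

namespace Reshuffling

variable {N : ℕ}

/-! ### The total remaining work -/

/-- The number of transmissions needed to clear the network. -/
def work (n : State N) : ℕ := ∑ i : Fin (N - 1), (N - 1 - i) * n i

theorem work_arrive (hN : 2 ≤ N) (n : State N) : work (arrive n) = work n + (N - 1) := by
  have h : ∀ j : Fin (N - 1), (N - 1 - (j : ℕ)) * arrive n j =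
      (N - 1 - j) * n j + if j = ⟨0, by omega⟩ then N - 1 else 0 := fun j => by
    by_cases hj : (j : ℕ) = 0
    · simp [arrive, Fin.ext_iff, hj, mul_add]
    · simp [arrive, Fin.ext_iff, hj]
  unfold work
  simp only [h, Finset.sum_add_distrib, Finset.sum_ite_eq', Finset.mem_univ, if_true]

theorem work_advance {n : State N} {i : Fin (N - 1)} (hi : 0 < n i) :
    work (advance n i) + 1 = work n := by
  have h : ∀ j : Fin (N - 1), (N - 1 - (j : ℕ)) * advance n i j + (if j = i then N - 1 - i else 0) =
      (N - 1 - j) * n j + if (j : ℕ) = i + 1 then N - 1 - (i + 1) else 0 := fun j => by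
    by_cases hj : j = i
    · subst hj
      obtain ⟨m, hm⟩ := Nat.exists_eq_add_of_lt hi
      simp [advance, hm, mul_add]
    · by_cases hj' : (j : ℕ) = i + 1
      · simp [advance, hj, hj', mul_add]
      · simp [advance, hj, hj']
  have hs := Finset.sum_congr (rfl : (Finset.univ : Finset (Fin (N - 1))) = _) fun j _ => h j
  simp only [Finset.sum_add_distrib, Finset.sum_ite_eq', Finset.mem_univ, if_true] at hs
  -- For the last stage no `j` qualifies and the truncated weight is 0, so a departure obeys the
  -- same formula.
  have hlast : ∑ j : Fin (N - 1), (if (j : ℕ) = i + 1 then N - 1 - ((i : ℕ) + 1) else 0) =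
      N - 1 - (i + 1) := by
    by_cases hi' : (i : ℕ) + 1 < N - 1
    · have := Finset.sum_ite_eq' (Finset.univ : Finset (Fin (N - 1))) ⟨i + 1, hi'⟩
        fun _ => N - 1 - ((i : ℕ) + 1)
      simpa [Fin.ext_iff] using this
    · rw [Nat.sub_eq_zero_of_le (not_lt.mp hi')]
      simp
  have := i.isLt
  unfold work
  omega

/-! ### Placements and useful packets -/

theorem exists_placement {u v : Fin N} (huv : v ≠ u) (i : Fin (N - 1)) :
    ∃ A : {A : Finset (Fin N) // A.card = (i : ℕ) + 1}, u ∈ A.1 ∧ v ∉ A.1 := by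
  obtain ⟨A, h1, h2, h3⟩ := Finset.exists_subsuperset_card_eq (s := {u})
    (t := Finset.univ.erase v) (n := (i : ℕ) + 1) (by simpa using huv.symm) (by simp) (by
      rw [Finset.card_erase_of_mem (Finset.mem_univ v), Finset.card_univ, Fintype.card_fin]
      omega)
  exact ⟨⟨A, h3⟩, h1 (Finset.mem_singleton_self u), fun hv => by simpa using h2 hv⟩

theorem exists_mem_useful {u v : Fin N} (huv : v ≠ u) (n : State N) :
    ∃ ω : Placement n, ∀ p, p ∈ useful ω u v := by
  choose A hu hv using exists_placement huv
  exact ⟨fun p => A p.1, fun p => Finset.mem_filter.mpr ⟨Finset.mem_univ p, hu _, hv _⟩⟩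

theorem card_placement_ne_zero (hN : 2 ≤ N) (n : State N) :
    (Fintype.card (Placement n) : ℝ≥0) ≠ 0 := by
  obtain ⟨ω, -⟩ := exists_mem_useful (u := ⟨0, by omega⟩) (v := ⟨1, by omega⟩) (by simp) n
  have : Nonempty (Placement n) := ⟨ω⟩
  exact Nat.cast_ne_zero.mpr Fintype.card_ne_zero

/-- The probability that some packet is useful on the link `(u, v)` after the reshuffle. -/
def usefulProb (u v : Fin N) (n : State N) : ℝ≥0 :=
  (Fintype.card (Placement n) : ℝ≥0)⁻¹ * ∑ ω : Placement n, if (useful ω u v).Nonempty then 1 else 0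

theorem usefulProb_le_one (u v : Fin N) (n : State N) : usefulProb u v n ≤ 1 := by
  unfold usefulProb
  rw [Finset.sum_boole]
  refine (mul_le_mul' le_rfl (Nat.cast_le.mpr (Finset.card_le_univ _))).trans ?_
  exact inv_mul_le_one

/-- An upper bound for the probability that a given packet is not useful on a given link, uniform in
its stage. -/
def uselessRatio (N : ℕ) : ℝ≥0 := 1 - (2 ^ N)⁻¹

theorem uselessRatio_lt_one (N : ℕ) : uselessRatio N < 1 :=
  tsub_lt_self one_pos (by positivity)

/-- At least one of the at most `2 ^ N` possible sets separates `u` from `v`. -/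
theorem card_useless_le {u v : Fin N} (huv : v ≠ u) (i : Fin (N - 1)) :
    ((Finset.univ.filter fun A : {A : Finset (Fin N) // A.card = (i : ℕ) + 1} =>
      ¬(u ∈ A.1 ∧ v ∉ A.1)).card : ℝ≥0) ≤
      uselessRatio N * Fintype.card {A : Finset (Fin N) // A.card = (i : ℕ) + 1} := by
  set B := Finset.univ.filter fun A : {A : Finset (Fin N) // A.card = (i : ℕ) + 1} =>
      ¬(u ∈ A.1 ∧ v ∉ A.1) with hB
  set T := Fintype.card {A : Finset (Fin N) // A.card = (i : ℕ) + 1} with hT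
  have h1 : B.card + 1 ≤ T := by
    obtain ⟨A, hA⟩ := exists_placement huv i
    refine Nat.succ_le_of_lt (Finset.card_lt_univ_of_notMem (x := A) ?_)
    simp [hB, hA]
  have h2 : T ≤ 2 ^ N := by
    have := Fintype.card_subtype_le fun A : Finset (Fin N) => A.card = (i : ℕ) + 1
    simpa [Fintype.card_finset, hT] using this
  have h1' : (B.card : ℝ) + 1 ≤ T := by exact_mod_cast h1
  have h2' : (T : ℝ) ≤ 2 ^ N := by exact_mod_cast h2
  have hr : ((uselessRatio N : ℝ≥0) : ℝ) = 1 - (2 ^ N)⁻¹ := by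
    unfold uselessRatio
    rw [NNReal.coe_sub (inv_le_one_of_one_le₀ (one_le_pow₀ one_le_two))]
    simp
  rw [← NNReal.coe_le_coe]
  push_cast
  rw [hr, sub_mul, one_mul]
  have h3 : (2 ^ N : ℝ)⁻¹ * T ≤ 1 := by
    rw [inv_mul_le_iff₀ (by positivity), mul_one]
    exact h2'
  linarith

theorem one_le_usefulProb_add (hN : 2 ≤ N) {u v : Fin N} (huv : v ≠ u) (n : State N) :
    1 ≤ usefulProb u v n + uselessRatio N ^ ∑ i, n i := by
  have hcard := card_placement_ne_zero hN n
  have hsplit : (Finset.univ.filter fun ω : Placement n => (useful ω u v).Nonempty).card +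
      (Finset.univ.filter fun ω : Placement n => ¬ (useful ω u v).Nonempty).card =
      Fintype.card (Placement n) := by
    rw [Finset.card_filter_add_card_filter_not, Finset.card_univ]
  have hbad : ((Finset.univ.filter fun ω : Placement n => ¬ (useful ω u v).Nonempty).card : ℝ≥0) ≤
      uselessRatio N ^ (∑ i, n i) * Fintype.card (Placement n) := by
    -- Independence: placements useful for no packet form a product over packets, so their count
    -- factors.
    have hpi : (Finset.univ.filter fun ω : Placement n => ¬ (useful ω u v).Nonempty) =
        Fintype.piFinset fun p : Packet n => Finset.univ.filter
          fun A : {A : Finset (Fin N) // A.card = (p.1 : ℕ) + 1} => ¬(u ∈ A.1 ∧ v ∉ A.1) := by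
      ext ω
      simp [useful, Finset.filter_eq_empty_iff]
    rw [hpi, Fintype.card_piFinset, Fintype.card_pi]
    push_cast
    have hpk : ∑ i, n i = (Finset.univ : Finset (Packet n)).card := by
      simp [Finset.card_univ, Fintype.card_sigma]
    rw [hpk, ← Finset.prod_const, ← Finset.prod_mul_distrib]
    exact Finset.prod_le_prod' fun p _ => card_useless_le huv p.1
  unfold usefulProb
  rw [Finset.sum_boole, ← mul_le_mul_iff_right₀ (pos_iff_ne_zero.mpr hcard), mul_add,
    mul_inv_cancel_left₀ hcard, mul_one]
  have h : (Fintype.card (Placement n) : ℝ≥0) =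
      ((Finset.univ.filter fun ω : Placement n => (useful ω u v).Nonempty).card : ℝ≥0) +
      ((Finset.univ.filter fun ω : Placement n => ¬ (useful ω u v).Nonempty).card : ℝ≥0) := by
    exact_mod_cast hsplit.symm
  calc _ = _ := h
    _ ≤ _ := by
      gcongr
      rw [mul_comm]
      exact hbad

/-! ### Transition rates -/

theorem tsum_ite_eq_mul (a : State N) (f : State N → ℝ≥0∞) :
    ∑' m, (((if m = a then 1 else 0 : ℝ≥0)) : ℝ≥0∞) * f m = f a := by
  rw [tsum_eq_single a fun m hm => by simp [hm]]
  simp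

theorem tsum_transmissionProb_mul (u v : Fin N) (n : State N) (f : State N → ℝ≥0∞) :
    ∑' m, (transmissionProb u v n m : ℝ≥0∞) * f m =
      ((Fintype.card (Placement n) : ℝ≥0)⁻¹ : ℝ≥0) * ∑ ω : Placement n, ∑ p ∈ useful ω u v,
        (((useful ω u v).card : ℝ≥0)⁻¹ : ℝ≥0) * f (advance n p.1) := by
  unfold transmissionProb
  simp_rw [ENNReal.coe_mul, ENNReal.ofNNReal_finsetSum, ENNReal.coe_mul, mul_assoc,
    ENNReal.tsum_mul_left, Finset.sum_mul]
  rw [Summable.tsum_finsetSum fun _ _ => ENNReal.summable]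
  congr 1
  refine Finset.sum_congr rfl fun ω _ => ?_
  rw [Summable.tsum_finsetSum fun _ _ => ENNReal.summable]
  refine Finset.sum_congr rfl fun p _ => ?_
  simp_rw [mul_assoc]
  rw [ENNReal.tsum_mul_left, tsum_ite_eq_mul]

/-- When `f` changes by the same amount for every packet, the choice of packet is irrelevant and
only the probability that one is useful remains. The additive form avoids subtraction in `ℝ≥0∞`. -/
theorem tsum_transmissionProb_mul_add {u v : Fin N} {n : State N} {f : State N → ℝ≥0∞}
    {d g : ℝ≥0∞} (h : ∀ p : Packet n, f (advance n p.1) + d = g) :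
    ∑' m, (transmissionProb u v n m : ℝ≥0∞) * f m + d * usefulProb u v n =
      g * usefulProb u v n := by
  rw [tsum_transmissionProb_mul]
  unfold usefulProb
  rw [ENNReal.coe_mul, mul_left_comm d, mul_left_comm g, ← mul_add]
  congr 1
  rw [ENNReal.ofNNReal_finsetSum, Finset.mul_sum, Finset.mul_sum, ← Finset.sum_add_distrib]
  refine Finset.sum_congr rfl fun ω _ => ?_
  rcases (useful ω u v).eq_empty_or_nonempty with he | hne
  · simp [he]
  have hc : ((useful ω u v).card : ℝ≥0) ≠ 0 := Nat.cast_ne_zero.mpr hne.card_pos.ne'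
  have h1 : ∑ _p ∈ useful ω u v, ((((useful ω u v).card : ℝ≥0)⁻¹ : ℝ≥0) : ℝ≥0∞) = 1 := by
    rw [Finset.sum_const, nsmul_eq_mul, ← ENNReal.coe_natCast, ← ENNReal.coe_mul,
      mul_inv_cancel₀ hc, ENNReal.coe_one]
  simp only [hne, if_true, ENNReal.coe_one, mul_one]
  calc _ = ∑ p ∈ useful ω u v, ((((useful ω u v).card : ℝ≥0)⁻¹ : ℝ≥0) : ℝ≥0∞) *
          (f (advance n p.1) + d) := by
        simp_rw [mul_add]
        rw [Finset.sum_add_distrib, ← Finset.sum_mul _ _ d, h1, one_mul]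
    _ = _ := by
        simp_rw [h]
        rw [← Finset.sum_mul, h1, one_mul]

/-- The total rate of transmissions in the state `n`. -/
def transmissionRate (n : State N) : ℝ≥0 :=
  ∑ u : Fin N, ∑ v ∈ Finset.univ.filter (fun v => v ≠ u), usefulProb u v n

theorem sum_links_const (c : ℝ≥0) :
    ∑ u : Fin N, ∑ _v ∈ Finset.univ.filter (fun v => v ≠ u), c = N * (N - 1 : ℕ) * c := by
  have h : ∀ u : Fin N, (Finset.univ.filter (fun v => v ≠ u)).card = N - 1 := fun u => by
    rw [Finset.filter_ne', Finset.card_erase_of_mem (Finset.mem_univ u), Finset.card_univ,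
      Fintype.card_fin]
  simp [h, mul_assoc]

theorem transmissionRate_le (n : State N) : transmissionRate n ≤ N * (N - 1 : ℕ) := by
  rw [← mul_one ((N : ℝ≥0) * (N - 1 : ℕ)), ← sum_links_const]
  exact Finset.sum_le_sum fun u _ => Finset.sum_le_sum fun v _ => usefulProb_le_one u v n

theorem le_transmissionRate_add (hN : 2 ≤ N) (n : State N) :
    (N * (N - 1 : ℕ) : ℝ≥0) ≤
      transmissionRate n + N * (N - 1 : ℕ) * uselessRatio N ^ ∑ i, n i := by
  rw [← sum_links_const, ← mul_one ((N : ℝ≥0) * (N - 1 : ℕ)), ← sum_links_const]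
  unfold transmissionRate
  simp_rw [← Finset.sum_add_distrib]
  exact Finset.sum_le_sum fun u _ => Finset.sum_le_sum fun v hv =>
    one_le_usefulProb_add hN (Finset.mem_filter.mp hv).2 n

theorem tsum_transitionRate_mul_add (lam : ℝ≥0) {n : State N} {f : State N → ℝ≥0∞}
    {d g : ℝ≥0∞} (h : ∀ p : Packet n, f (advance n p.1) + d = g) :
    ∑' m, (transitionRate lam n m : ℝ≥0∞) * f m + d * transmissionRate n =
      N * lam * f (arrive n) + g * transmissionRate n := by
  have harr : ∀ m, ((∑ _u : Fin N, lam * if m = arrive n then 1 else 0 : ℝ≥0) : ℝ≥0∞) =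
      N * lam * ((if m = arrive n then 1 else 0 : ℝ≥0) : ℝ≥0∞) := fun m => by
    rw [Finset.sum_const, Finset.card_univ, Fintype.card_fin, nsmul_eq_mul]
    push_cast
    ring
  unfold transitionRate transmissionRate
  simp_rw [ENNReal.coe_add, add_mul, harr, ENNReal.tsum_add, mul_assoc, ENNReal.tsum_mul_left,
    tsum_ite_eq_mul, ENNReal.ofNNReal_finsetSum, Finset.sum_mul]
  rw [add_assoc]
  congr 1
  rw [Summable.tsum_finsetSum fun _ _ => ENNReal.summable, Finset.mul_sum, Finset.mul_sum,
    ← Finset.sum_add_distrib]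
  refine Finset.sum_congr rfl fun u _ => ?_
  rw [Summable.tsum_finsetSum fun _ _ => ENNReal.summable, Finset.mul_sum, Finset.mul_sum,
    ← Finset.sum_add_distrib]
  exact Finset.sum_congr rfl fun v _ => tsum_transmissionProb_mul_add h

/-! ### Drift of the work, irreducibility and the two regimes -/

section Chain

variable (hN : 2 ≤ N) (lam : ℝ≥0) (hlam : 0 < lam)

theorem exitRate_chain (n : State N) :
    (chain N hN lam hlam).exitRate n = N * lam + transmissionRate n := by
  have h := tsum_transitionRate_mul_add lam (n := n) (f := fun _ => 1) (d := 0) (g := 1)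
    fun _ => add_zero _
  simp only [mul_one, zero_mul, add_zero, one_mul] at h
  unfold TransitionRates.exitRate
  rw [← ENNReal.coe_inj, ENNReal.coe_tsum ((chain N hN lam hlam).summable_rate n)]
  push_cast
  exact h

theorem tsum_rate_mul_work (n : State N) :
    ∑' m, ((chain N hN lam hlam).rate n m : ℝ≥0∞) * (work m : ℝ≥0∞) + transmissionRate n =
      (chain N hN lam hlam).exitRate n * work n + N * (N - 1 : ℕ) * lam := by
  have h := tsum_transitionRate_mul_add lam (n := n) (f := fun m => (work m : ℝ≥0∞)) (d := 1)
    (g := work n) fun p => by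
      exact_mod_cast work_advance p.2.pos
  rw [one_mul] at h
  refine h.trans ?_
  rw [exitRate_chain, work_arrive hN]
  push_cast
  ring

theorem eq_arrive_or_advance {lam : ℝ≥0} {n m : State N} (h : 0 < transitionRate lam n m) :
    m = arrive n ∨ ∃ i, 0 < n i ∧ m = advance n i := by
  by_contra hm
  push Not at hm
  obtain ⟨h1, h2⟩ := hm
  have h3 : ∀ p : Packet n, m ≠ advance n p.1 := fun p => h2 p.1 p.2.pos
  simp [transitionRate, transmissionProb, h1, h3] at h

theorem work_le_of_rate_pos {lam : ℝ≥0} {n m : State N} (hN : 2 ≤ N)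
    (h : 0 < transitionRate lam n m) : work m ≤ work n + (N - 1) := by
  rcases eq_arrive_or_advance h with rfl | ⟨i, hi, rfl⟩
  · exact (work_arrive hN n).le
  · have := work_advance hi
    omega

theorem transitionRate_advance_pos {n : State N} (hN : 2 ≤ N) {i : Fin (N - 1)} (hi : 0 < n i) :
    0 < transitionRate lam n (advance n i) := by
  let u : Fin N := ⟨0, by omega⟩
  let v : Fin N := ⟨1, by omega⟩
  have huv : v ≠ u := by simp [u, v]
  obtain ⟨ω, hω⟩ := exists_mem_useful huv n
  let p : Packet n := ⟨i, ⟨0, hi⟩⟩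
  have h1 : 0 < transmissionProb u v n (advance n i) := by
    unfold transmissionProb
    refine mul_pos (inv_pos.mpr (pos_iff_ne_zero.mpr (card_placement_ne_zero hN n))) ?_
    refine Finset.sum_pos' (fun _ _ => zero_le) ⟨ω, Finset.mem_univ _, ?_⟩
    refine Finset.sum_pos' (fun _ _ => zero_le) ⟨p, hω p, ?_⟩
    have : 0 < (useful ω u v).card := Finset.card_pos.mpr ⟨p, hω p⟩
    simp only [p, if_true, mul_one]
    positivity
  refine add_pos_of_nonneg_of_pos zero_le ?_
  refine Finset.sum_pos' (fun _ _ => zero_le) ⟨u, Finset.mem_univ _, ?_⟩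
  exact Finset.sum_pos' (fun _ _ => zero_le)
    ⟨v, Finset.mem_filter.mpr ⟨Finset.mem_univ _, huv⟩, h1⟩

theorem reaches_zero (n : State N) :
    Relation.ReflTransGen (fun a b => 0 < (chain N hN lam hlam).rate a b) n 0 := by
  induction hk : work n using Nat.strong_induction_on generalizing n with
  | _ k ih =>
    by_cases h0 : n = 0
    · rw [h0]
    obtain ⟨i, hi⟩ := Function.ne_iff.mp h0
    have hi' : 0 < n i := Nat.pos_of_ne_zero hi
    have hw := work_advance hi'
    exact Relation.ReflTransGen.head (transitionRate_advance_pos lam hN hi')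
      (ih (work (advance n i)) (by omega) _ rfl)

/-- The number of transmissions made for the packets present in the state `n`, with the arrival of
a packet counted as a transmission. -/
def progress (n : State N) : ℕ := ∑ i : Fin (N - 1), ((i : ℕ) + 1) * n i

theorem exists_rate_pos_to {n : State N} (h0 : n ≠ 0) :
    ∃ m, progress m < progress n ∧ 0 < (chain N hN lam hlam).rate m n := by
  obtain ⟨i, hi⟩ := Function.ne_iff.mp h0
  obtain ⟨a, ha⟩ := Nat.exists_eq_add_of_lt (Nat.pos_of_ne_zero hi)
  rw [zero_add] at ha
  -- Undo the last move of one packet at index `i`: put it back at `i - 1`, or delete it if `i = 0`.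
  let m : State N := fun j => if j = i then n j - 1 else if (j : ℕ) + 1 = i then n j + 1 else n j
  have hm : ∀ j : Fin (N - 1), ((j : ℕ) + 1) * m j + (if j = i then (i : ℕ) + 1 else 0) =
      (j + 1) * n j + if (j : ℕ) + 1 = i then (i : ℕ) else 0 := fun j => by
    by_cases hj : j = i
    · subst hj
      simp [m, ha, mul_add]
    · by_cases hj' : (j : ℕ) + 1 = i
      · simp [m, hj, hj', mul_add]
      · simp [m, hj, hj']
  have hs := Finset.sum_congr (rfl : (Finset.univ : Finset (Fin (N - 1))) = _) fun j _ => hm j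
  simp only [Finset.sum_add_distrib, Finset.sum_ite_eq', Finset.mem_univ, if_true] at hs
  have hlast : ∑ j : Fin (N - 1), (if (j : ℕ) + 1 = i then (i : ℕ) else 0) ≤ i := by
    rw [← Finset.sum_filter, Finset.sum_const, smul_eq_mul]
    refine mul_le_of_le_one_left' (Finset.card_le_one.mpr fun j hj k hk => ?_)
    simp only [Finset.mem_filter, Finset.mem_univ, true_and] at hj hk
    exact Fin.ext (by omega)
  refine ⟨m, ?_, ?_⟩
  · unfold progress
    omega
  by_cases hi0 : (i : ℕ) = 0
  · have : n = arrive m := by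
      funext j
      by_cases hj : j = i
      · subst hj
        simp [arrive, m, hi0, ha]
      · have hj0 : (j : ℕ) ≠ 0 := fun h => hj (Fin.ext (by omega))
        simp [arrive, m, hj, hj0, hi0]
    rw [this]
    exact transitionRate_arrive_pos hN hlam m
  · have hk : (i : ℕ) - 1 < N - 1 := by omega
    have hki : (⟨i - 1, hk⟩ : Fin (N - 1)) ≠ i := fun h => by
      have := congrArg Fin.val h
      simp only at this
      omega
    have hk1 : (i : ℕ) - 1 + 1 = i := by omega
    have : n = advance m ⟨i - 1, hk⟩ := by
      funext j
      by_cases hj : j = i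
      · subst hj
        simp [advance, m, hki.symm, hk1, ha]
      · by_cases hj' : j = ⟨i - 1, hk⟩
        · subst hj'
          simp [advance, m, hki, hk1]
        · have h1 : (j : ℕ) + 1 ≠ i := fun h => hj' (Fin.ext (by simp; omega))
          have h2 : (j : ℕ) ≠ i := fun h => hj (Fin.ext h)
          simp [advance, m, hj, hj', h1, hk1, h2]
    rw [this]
    exact transitionRate_advance_pos lam hN (by simp [m, hki, hk1])

theorem reachable_from_zero (n : State N) :
    Relation.ReflTransGen (fun a b => 0 < (chain N hN lam hlam).rate a b) 0 n := by
  induction hk : progress n using Nat.strong_induction_on generalizing n with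
  | _ k ih =>
    by_cases h0 : n = 0
    · rw [h0]
    obtain ⟨m, hm, hr⟩ := exists_rate_pos_to hN lam hlam h0
    exact (ih _ (hk ▸ hm) m rfl).tail hr

/-- An arrival supplies the nonempty path required even when `n = m`; then the network empties and
the target is built up from 0. -/
theorem reaches (n m : State N) :
    Relation.TransGen (fun a b => 0 < (chain N hN lam hlam).rate a b) n m :=
  Relation.TransGen.head' (transitionRate_arrive_pos hN hlam n)
    ((reaches_zero hN lam hlam _).trans (reachable_from_zero hN lam hlam m))

theorem le_exitRate (n : State N) : N * lam ≤ (chain N hN lam hlam).exitRate n := by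
  rw [exitRate_chain]
  exact le_self_add

theorem exitRate_le (n : State N) :
    (chain N hN lam hlam).exitRate n ≤ N * lam + N * (N - 1 : ℕ) := by
  rw [exitRate_chain]
  gcongr
  exact transmissionRate_le n

theorem isPositiveRecurrent_iff : (chain N hN lam hlam).IsPositiveRecurrent ↔
    ∀ x, ∑' k, ((chain N hN lam hlam).tabooStep x)^[k] 1 x < ⊤ := by
  have hN0 : (0 : ℝ≥0) < N := by exact_mod_cast (by omega : 0 < N)
  exact forall_congr' fun x => (chain N hN lam hlam).lintegral_returnTime_lt_top_iff
    (by positivity) (le_exitRate hN lam hlam) (exitRate_le hN lam hlam) x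

theorem step_work_le (n : State N) :
    (chain N hN lam hlam).step (fun m => (work m : ℝ≥0∞)) n ≤ work n + (N - 1 : ℕ) := by
  set Q := chain N hN lam hlam
  calc Q.step (fun m => (work m : ℝ≥0∞)) n
      ≤ ∑' m, Q.jumpPMF n m * ((work n : ℝ≥0∞) + (N - 1 : ℕ)) := by
        refine ENNReal.tsum_le_tsum fun m => ?_
        by_cases h : Q.jumpPMF n m = 0
        · simp [h]
        dsimp only
        gcongr
        exact_mod_cast work_le_of_rate_pos hN (Q.jumpPMF_ne_zero_iff.mp h)
    _ = _ := by rw [ENNReal.tsum_mul_right, PMF.tsum_coe, one_mul]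

theorem coe_exitRate_ne_zero (n : State N) :
    ((chain N hN lam hlam).exitRate n : ℝ≥0∞) ≠ 0 := by
  have hN0 : (0 : ℝ≥0) < N := by exact_mod_cast (by omega : 0 < N)
  exact ENNReal.coe_ne_zero.mpr ((by positivity : 0 < N * lam).trans_le
    (le_exitRate hN lam hlam n)).ne'

theorem not_isPositiveRecurrent_of_one_le (h1 : 1 ≤ lam) :
    ¬ (chain N hN lam hlam).IsPositiveRecurrent := by
  rw [isPositiveRecurrent_iff]
  intro h
  set Q := chain N hN lam hlam with hQ
  refine (h 0).ne (Q.tsum_iterate_tabooStep_eq_top_of_drift (W := fun m => (work m : ℝ≥0∞))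
    (c := (N - 1 : ℕ)) (ENNReal.natCast_ne_top _) ?_ (by simp [work]) ?_ ?_)
  · intro y z hyz
    exact_mod_cast work_le_of_rate_pos hN hyz
  · intro y
    rw [Q.step_eq, mul_comm, ← div_eq_mul_inv, ENNReal.le_div_iff_mul_le
      (Or.inl (coe_exitRate_ne_zero hN lam hlam y)) (Or.inl ENNReal.coe_ne_top), mul_comm]
    refine (ENNReal.add_le_add_iff_right (ENNReal.coe_ne_top (r := transmissionRate y))).mp ?_
    rw [tsum_rate_mul_work hN lam hlam]
    gcongr
    have : transmissionRate y ≤ N * (N - 1 : ℕ) * lam :=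
      (transmissionRate_le y).trans (le_mul_of_one_le_right' h1)
    exact_mod_cast this
  -- From the empty state an arrival has positive probability and creates work `N - 1 > 0`.
  · intro h0
    have h2 := ENNReal.tsum_eq_zero.mp h0 (arrive 0)
    rcases mul_eq_zero.mp h2 with h3 | h3
    · exact Q.jumpPMF_ne_zero_iff.mpr (transitionRate_arrive_pos hN hlam 0) h3
    · have h4 : work (arrive (0 : State N)) = 0 := Nat.cast_eq_zero.mp h3
      have := work_arrive hN (0 : State N)
      omega

theorem exists_drift (h1 : lam < 1) : ∃ (ε : ℝ≥0∞) (M : ℕ), ε ≠ 0 ∧ ε ≠ ⊤ ∧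
    ∀ n : State N, M ≤ ∑ i, n i →
      (chain N hN lam hlam).step (fun m => (work m : ℝ≥0∞)) n + ε ≤ work n := by
  set Q := chain N hN lam hlam with hQ
  -- With `M` packets the fraction of wasted epochs falls below the spare capacity `1 - lam`; `η` is
  -- the remaining margin.
  obtain ⟨M, hM⟩ := exists_pow_lt_of_lt_one (tsub_pos_of_lt h1 : 0 < 1 - lam) (uselessRatio_lt_one N)
  set G : ℝ≥0 := N * (N - 1 : ℕ) with hG
  have hG0 : 0 < G := by
    have h2 : (0 : ℝ≥0) < N := by exact_mod_cast (by omega : 0 < N)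
    have h3 : (0 : ℝ≥0) < (N - 1 : ℕ) := by exact_mod_cast (by omega : 0 < N - 1)
    positivity
  set η : ℝ≥0 := 1 - lam - uselessRatio N ^ M with hη
  have hη0 : 0 < η := tsub_pos_of_lt hM
  have hsum : η + uselessRatio N ^ M + lam = 1 := by
    rw [hη, tsub_add_cancel_of_le hM.le, tsub_add_cancel_of_le h1.le]
  set b : ℝ≥0 := N * lam + N * (N - 1 : ℕ) with hb
  have hb0 : 0 < b := add_pos_of_nonneg_of_pos zero_le hG0
  -- The generator drift is at most `-G * η`; dividing by the bound `b` on exit rates gives a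
  -- uniform drift for the jump chain.
  refine ⟨(G * η / b : ℝ≥0), M, ENNReal.coe_ne_zero.mpr (by positivity), ENNReal.coe_ne_top,
    fun n hn => ?_⟩
  have hR : G * lam + G * η ≤ transmissionRate n := by
    have h2 := le_transmissionRate_add hN n
    rw [← hG] at h2
    have h3 : uselessRatio N ^ ∑ i, n i ≤ uselessRatio N ^ M :=
      pow_le_pow_of_le_one zero_le (uselessRatio_lt_one N).le hn
    refine (add_le_add_iff_right (G * uselessRatio N ^ M)).mp ?_
    calc G * lam + G * η + G * uselessRatio N ^ M = G * (η + uselessRatio N ^ M + lam) := by ring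
      _ = G := by rw [hsum, mul_one]
      _ ≤ _ := h2
      _ ≤ _ := by gcongr
  have hrate : ∑' m, (Q.rate n m : ℝ≥0∞) * (work m : ℝ≥0∞) + (G * η : ℝ≥0) ≤
      Q.exitRate n * work n := by
    refine (ENNReal.add_le_add_iff_right (ENNReal.coe_ne_top (r := G * lam))).mp ?_
    have h2 := tsum_rate_mul_work hN lam hlam n
    rw [← hQ] at h2
    calc _ = ∑' m, (Q.rate n m : ℝ≥0∞) * (work m : ℝ≥0∞) + ((G * lam + G * η : ℝ≥0) : ℝ≥0∞) := by
          push_cast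
          ring
      _ ≤ ∑' m, (Q.rate n m : ℝ≥0∞) * (work m : ℝ≥0∞) + transmissionRate n := by
          gcongr
      _ = _ := by
          rw [h2, hG]
          push_cast
          ring
  have hq0 := coe_exitRate_ne_zero hN lam hlam n
  rw [← hQ] at hq0
  have hε : ((G * η / b : ℝ≥0) : ℝ≥0∞) ≤ (Q.exitRate n : ℝ≥0∞)⁻¹ * (G * η : ℝ≥0) := by
    rw [← ENNReal.coe_inv (ENNReal.coe_ne_zero.mp hq0), ← ENNReal.coe_mul, ENNReal.coe_le_coe,
      div_eq_inv_mul]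
    gcongr
    · exact pos_iff_ne_zero.mpr (ENNReal.coe_ne_zero.mp hq0)
    · exact exitRate_le hN lam hlam n
  calc _ ≤ (Q.exitRate n : ℝ≥0∞)⁻¹ * ∑' m, (Q.rate n m : ℝ≥0∞) * (work m : ℝ≥0∞) +
        (Q.exitRate n : ℝ≥0∞)⁻¹ * (G * η : ℝ≥0) := by
        rw [Q.step_eq]
        gcongr
    _ ≤ (Q.exitRate n : ℝ≥0∞)⁻¹ * (Q.exitRate n * work n) := by
        rw [← mul_add]
        gcongr
    _ = work n := by
        rw [← mul_assoc, ENNReal.inv_mul_cancel hq0 ENNReal.coe_ne_top, one_mul]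

theorem isPositiveRecurrent_of_lt_one (h1 : lam < 1) :
    (chain N hN lam hlam).IsPositiveRecurrent := by
  rw [isPositiveRecurrent_iff]
  intro x
  set Q := chain N hN lam hlam with hQ
  obtain ⟨ε, M, hε0, hε_top, hdrift⟩ := exists_drift hN lam hlam h1
  -- This box contains every state with fewer than `M` packets.
  let F : Finset (State N) := Finset.Icc 0 fun _ => M
  refine Q.tsum_iterate_tabooStep_lt_top_of_drift (V := fun m => (work m : ℝ≥0∞))
    (ENNReal.natCast_ne_top _) (F := F) (ε := ε)
    (b := ∑ y ∈ F, (Q.step (fun m => (work m : ℝ≥0∞)) y + ε)) hε0 ?_ ?_ ?_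
    fun y _ => reaches hN lam hlam y x
  · refine ENNReal.sum_ne_top.mpr fun y _ => ENNReal.add_ne_top.mpr ⟨?_, hε_top⟩
    exact ne_top_of_le_ne_top (ENNReal.add_ne_top.mpr
      ⟨ENNReal.natCast_ne_top _, ENNReal.natCast_ne_top _⟩) (step_work_le hN lam hlam y)
  · intro y hy
    refine hdrift y ?_
    by_contra hlt
    refine hy (Finset.mem_Icc.mpr ⟨fun i => Nat.zero_le _, fun i => ?_⟩)
    exact (Finset.single_le_sum (f := y) (fun _ _ => Nat.zero_le _) (Finset.mem_univ i)).trans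
      (not_le.mp hlt).le
  · intro y hy
    exact Finset.single_le_sum (f := fun y => Q.step (fun m => (work m : ℝ≥0∞)) y + ε)
      (fun _ _ => zero_le) hy

end Chain

end Reshuffling
end

theorem mainTheorem7 (N : ℕ) (hN : 2 ≤ N) (lam : ℝ≥0) (hlam : 0 < lam) :
    (Reshuffling.chain N hN lam hlam).IsPositiveRecurrent ↔ lam < 1 := by
  refine ⟨fun h => ?_, Reshuffling.isPositiveRecurrent_of_lt_one hN lam hlam⟩
  by_contra h1
  exact Reshuffling.not_isPositiveRecurrent_of_one_le hN lam hlam (not_lt.mp h1) h
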